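/- For a nonnegative integer $n$, let $R_9(n)$ denote the number of $9$-regular partitions of $n$, i.e. the number of partitions of $n$ none of whose parts is divisible by $9$ (so $R_9(0)=1$). Then for all integers $n\ge 0$, $$R_9(4n+1)\equiv R_9(n)\pmod 3.$$ Moreover, for all integers $r\ge 1$ and $s\ge 1$, $$R_9\left((r-1)4^{s-1}+\frac{4^s-1}{3}\right)\equiv R_9(r)\pmod 3.$$ In particular, for all integers $s\ge 1$, $$R_9\left(\frac{4^s-1}{3}\right)\equiv 1,\qquad R_9\left(4^{s-1}+\frac{4^s-1}{3}\right)\equiv 2,\qquad R_9\left(2\cdot 4^{s-1}+\frac{4^s-1}{3}\right)\equiv 0\pmod 3.$$ -/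

import Mathlib

/-- `Rreg t n` is the number of `t`-regular partitions of `n`, that is, of partitions of `n` none of
whose parts is divisible by `t`. In particular `Rreg t 0 = 1` (the empty partition). -/
def Rreg (t n : ℕ) : ℕ :=
  (Nat.Partition.restricted n (fun a => ¬ t ∣ a)).card

section

open Finset

/-! Since 1 - q^(9i) ≡ (1 - q^i)^9 mod 3, the generating function of R_9 is ≡ ∏(1 - q^i)^8. So is
the left side of the Borwein identity ∏(1 - q^(3i))^3/(1 - q^i) = Σ q^E(a,b), with E = `eisForm`;
hence R_9(m) ≡ #{E = m} (`Rreg_nine_modEq`). Now 3E + 1 is the Eisenstein norm of (3a - 1, 3b), and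
3(4m + 1) + 1 = 4(3m + 1). As 2 is inert, multiplication by -2 carries {E = m} bijectively onto {E =
4m + 1}. The Borwein identity, needed only mod 3 and mod q^(m+1), comes from `qBinom_trisection`:
after truncation, Gaussian binomials far from the edges become 1/∏(1 - q^i). -/

/-- The finite product `∏ (1 - q ^ i)` over `1 ≤ i ≤ n`. -/
def qPoch {A : Type*} [CommRing A] (q : A) (n : ℕ) : A := ∏ i ∈ range n, (1 - q ^ (i + 1))

theorem qPoch_succ {A : Type*} [CommRing A] (q : A) (n : ℕ) :
    qPoch q (n + 1) = qPoch q n * (1 - q ^ (n + 1)) := prod_range_succ _ _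

/-- The Gaussian binomial coefficient with parameter `q`. -/
def qBinom {A : Type*} [CommRing A] (q : A) : ℕ → ℕ → A
  | _, 0 => 1
  | 0, _ + 1 => 0
  | n + 1, k + 1 => q ^ (k + 1) * qBinom q n (k + 1) + qBinom q n k

theorem qBinom_zero_right {A : Type*} [CommRing A] (q : A) (n : ℕ) : qBinom q n 0 = 1 := by
  cases n <;> rfl

theorem qBinom_eq_zero_of_lt {A : Type*} [CommRing A] (q : A) {n k : ℕ} (h : n < k) :
    qBinom q n k = 0 := by
  induction n generalizing k with
  | zero =>
    obtain ⟨k, rfl⟩ := Nat.exists_eq_add_of_lt h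
    simp [qBinom]
  | succ n ih =>
    obtain ⟨k, rfl⟩ := Nat.exists_eq_add_of_lt h
    simp only [qBinom]
    rw [ih (by omega), ih (by omega)]
    ring

theorem qBinom_mul_qPoch_mul_qPoch {A : Type*} [CommRing A] (q : A) (k l : ℕ) :
    qBinom q (k + l) k * (qPoch q k * qPoch q l) = qPoch q (k + l) := by
  obtain ⟨n, hn⟩ : ∃ n, n = k + l := ⟨_, rfl⟩
  induction n generalizing k l with
  | zero =>
    obtain ⟨rfl, rfl⟩ : k = 0 ∧ l = 0 := by omega
    simp [qBinom, qPoch]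
  | succ n ih =>
    rcases k with _ | k
    · simp [qBinom_zero_right, qPoch]
    rcases l with _ | l
    · have h := ih k 0 (by omega)
      have h0 : qBinom q k (k + 1) = 0 := qBinom_eq_zero_of_lt q (by omega)
      simp only [add_zero] at h ⊢
      simp only [qBinom, h0, qPoch_succ q k]
      linear_combination (1 - q ^ (k + 1)) * h
    · have h1 := ih (k + 1) l (by omega)
      have h2 := ih k (l + 1) (by omega)
      have e1 : k + 1 + (l + 1) = (k + 1 + l) + 1 := by ring
      have e2 : k + (l + 1) = k + 1 + l := by ring
      rw [e2] at h2
      rw [e1, qBinom, qPoch_succ q (k + 1 + l)]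
      rw [qPoch_succ q l] at h2 ⊢
      rw [qPoch_succ q k] at h1 ⊢
      linear_combination q ^ (k + 1) * (1 - q ^ (l + 1)) * h1 + (1 - q ^ (k + 1)) * h2

open Polynomial in
/-- The `q`-binomial theorem. -/
theorem coeff_prod_one_add_C_pow_mul_X {A : Type*} [CommRing A] (q : A) (n k : ℕ) :
    (∏ i ∈ range n, (1 + C (q ^ i) * X : A[X])).coeff k = q ^ k.choose 2 * qBinom q n k := by
  induction n generalizing k with
  | zero =>
    rcases k with _ | k
    · simp [qBinom]
    · simp [qBinom, coeff_one]
  | succ n ih =>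
    have h : ∏ i ∈ range (n + 1), (1 + C (q ^ i) * X : A[X]) =
        (∏ i ∈ range n, (1 + C (q ^ i) * X : A[X])).comp (C q * X) * (1 + X) := by
      rw [prod_range_succ', Polynomial.prod_comp]
      simp only [add_comp, one_comp, mul_comp, C_comp, X_comp, pow_zero, map_one, one_mul,
        ← mul_assoc, ← C_mul, ← pow_succ]
    rw [h, mul_add, mul_one]
    rcases k with _ | k
    · rw [coeff_add, coeff_mul_X_zero, comp_C_mul_X_coeff, ih]
      simp [qBinom_zero_right]
    · rw [coeff_add, coeff_mul_X, comp_C_mul_X_coeff, comp_C_mul_X_coeff, ih, ih, qBinom,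
        Nat.choose_succ_succ' k 1, Nat.choose_one_right]
      ring

-- Split the product of the q-binomial theorem by i mod 3 and compare coefficients.
open Polynomial in
theorem qBinom_trisection {A : Type*} [CommRing A] (q : A) (N k : ℕ) :
    q ^ k.choose 2 * qBinom q (3 * N) k =
      ∑ x ∈ antidiagonal k, ∑ y ∈ antidiagonal x.1,
        q ^ (3 * (y.1.choose 2 + y.2.choose 2 + x.2.choose 2) + y.2 + 2 * x.2) *
          (qBinom (q ^ 3) N y.1 * qBinom (q ^ 3) N y.2 * qBinom (q ^ 3) N x.2) := by
  have h : ∏ i ∈ range (3 * N), (1 + C (q ^ i) * X : A[X]) =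
      (∏ i ∈ range N, (1 + C ((q ^ 3) ^ i) * X : A[X])) *
      (∏ i ∈ range N, (1 + C ((q ^ 3) ^ i) * X : A[X])).comp (C q * X) *
      (∏ i ∈ range N, (1 + C ((q ^ 3) ^ i) * X : A[X])).comp (C (q ^ 2) * X) := by
    induction N with
    | zero => simp
    | succ N ih =>
      rw [show 3 * (N + 1) = 3 * N + 1 + 1 + 1 by ring]
      simp only [prod_range_succ, ih, mul_comp, add_comp, one_comp, C_comp, X_comp]
      simp only [map_pow]
      ring
  rw [← coeff_prod_one_add_C_pow_mul_X, h, coeff_mul]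
  refine sum_congr rfl fun x _ => ?_
  rw [coeff_mul, sum_mul]
  refine sum_congr rfl fun y _ => ?_
  simp only [comp_C_mul_X_coeff, coeff_prod_one_add_C_pow_mul_X]
  ring

theorem map_qBinom {A B : Type*} [CommRing A] [CommRing B] (f : A →+* B) (q : A) (n k : ℕ) :
    f (qBinom q n k) = qBinom (f q) n k := by
  induction n generalizing k with
  | zero => cases k <;> simp [qBinom]
  | succ n ih => cases k <;> simp [qBinom, ih]

theorem map_qPoch {A B : Type*} [CommRing A] [CommRing B] (f : A →+* B) (q : A) (n : ℕ) :
    f (qPoch q n) = qPoch (f q) n := by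
  simp [qPoch]

/-! ### Truncation: nilpotent q -/

theorem qPoch_eq_of_pow_eq_zero {A : Type*} [CommRing A] {q : A} {m : ℕ} (hq : q ^ (m + 1) = 0)
    {k : ℕ} (hk : m ≤ k) : qPoch q k = qPoch q m := by
  induction k, hk using Nat.le_induction with
  | base => rfl
  | succ k hk ih => rw [qPoch_succ, ih, pow_eq_zero_of_le (by omega) hq, sub_zero, mul_one]

theorem isUnit_qPoch_of_isNilpotent {A : Type*} [CommRing A] {q : A} (hq : IsNilpotent q) (n : ℕ) :
    IsUnit (qPoch q n) := by
  induction n with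
  | zero => simp [qPoch]
  | succ n ih =>
    rw [qPoch_succ]
    exact ih.mul (hq.pow_succ n).isUnit_one_sub

theorem qBinom_mul_qPoch_of_pow_eq_zero {A : Type*} [CommRing A] {q : A} {m : ℕ}
    (hq : q ^ (m + 1) = 0) {n k : ℕ} (hk : m ≤ k) (hn : k + m ≤ n) :
    qBinom q n k * qPoch q m = 1 := by
  obtain ⟨l, rfl⟩ := Nat.exists_eq_add_of_le (show k ≤ n by omega)
  have h := qBinom_mul_qPoch_mul_qPoch q k l
  rw [qPoch_eq_of_pow_eq_zero hq hk, qPoch_eq_of_pow_eq_zero hq (show m ≤ l by omega),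
    qPoch_eq_of_pow_eq_zero hq (show m ≤ k + l by omega)] at h
  refine (isUnit_qPoch_of_isNilpotent ⟨_, hq⟩ m).mul_right_cancel ?_
  rw [one_mul, mul_assoc, h]

theorem qPoch_pow_char {A : Type*} [CommRing A] (p : ℕ) [Fact p.Prime] [CharP A p] (q : A) (n : ℕ) :
    qPoch (q ^ p) n = qPoch q n ^ p := by
  simp only [qPoch, ← prod_pow, sub_pow_char, one_pow, ← pow_mul, mul_comm]

/-! ### The Eisenstein form -/

/-- The quadratic polynomial with `3 * E + 1 = x² + xy + y²` for `x = 3a - 1`, `y = 3b`. -/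
def eisForm (a b : ℤ) : ℤ := 3 * (a ^ 2 + a * b + b ^ 2) - 2 * a - b

theorem eisForm_nonneg (a b : ℤ) : 0 ≤ eisForm a b := by
  have : 0 ≤ 4 * (3 * eisForm a b + 1) := by
    have e : 4 * (3 * eisForm a b + 1) = (6 * a - 2 + 3 * b) ^ 2 + 27 * b ^ 2 := by
      unfold eisForm; ring
    rw [e]; positivity
  omega

theorem eisForm_bounds {a b : ℤ} {m : ℕ} (h : eisForm a b ≤ m) :
    |a| ≤ m + 1 ∧ |b| ≤ m + 1 ∧ |a + b| ≤ m + 1 := by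
  have hm : (0 : ℤ) ≤ m := Int.natCast_nonneg m
  -- With x = 3a - 1, y = 3b, four times the norm is (x + 2y)² + 3x² = (2x + y)² + 3y² = (x - y)² +
  -- 3(x + y)².
  have key : ∀ x y : ℤ, x ^ 2 + 3 * y ^ 2 ≤ 4 * (3 * m + 1) → |y| ≤ 2 * m + 2 := fun x y hxy => by
    refine abs_le_of_sq_le_sq ?_ (by omega)
    nlinarith [sq_nonneg x]
  unfold eisForm at h
  have h1 := key (3 * a - 1 + 6 * b) (3 * a - 1) (by linarith)
  have h2 := key (6 * a - 2 + 3 * b) (3 * b) (by linarith)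
  have h3 := key (3 * a - 1 - 3 * b) (3 * a - 1 + 3 * b) (by linarith)
  rw [abs_le] at h1 h2 h3
  simp only [abs_le]
  refine ⟨?_, ?_, ?_⟩ <;> omega

theorem Int.two_mul_cast_choose_two (k : ℕ) : (2 * (k.choose 2 : ℕ) : ℤ) = k * (k - 1) := by
  induction k with
  | zero => simp
  | succ k ih =>
    rw [Nat.choose_succ_succ' k 1, Nat.choose_one_right]
    push_cast
    linear_combination ih

theorem trisection_exponent {n a b c : ℕ} (h : a + b + c = 3 * n) :
    3 * (a.choose 2 + b.choose 2 + c.choose 2) + b + 2 * c =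
      (3 * n).choose 2 + (eisForm (a - n) (b - n)).toNat := by
  zify
  rw [Int.toNat_of_nonneg (eisForm_nonneg _ _)]
  have ha := Int.two_mul_cast_choose_two a
  have hb := Int.two_mul_cast_choose_two b
  have hc := Int.two_mul_cast_choose_two c
  have hn := Int.two_mul_cast_choose_two (3 * n)
  obtain hc' : (c : ℤ) = 3 * n - a - b := by omega
  unfold eisForm
  rw [hc'] at hc ⊢
  push_cast at hn
  refine mul_left_cancel₀ (two_ne_zero (α := ℤ)) ?_
  linear_combination 3 * (ha + hb + hc) - hn

/-- The index set of the triple convolution in `qBinom_trisection`. -/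
def tripleIdx (n : ℕ) : Finset (Σ _ : ℕ × ℕ, ℕ × ℕ) :=
  (antidiagonal (3 * n)).sigma fun x => antidiagonal x.1

theorem qBinom_six_three {A : Type*} [CommRing A] [IsDomain A] {q : A} (hq : q ≠ 0) (n : ℕ) :
    qBinom q (3 * (2 * n)) (3 * n) = ∑ t ∈ tripleIdx n,
      q ^ (eisForm (t.2.1 - n) (t.2.2 - n)).toNat *
        (qBinom (q ^ 3) (2 * n) t.2.1 * qBinom (q ^ 3) (2 * n) t.2.2 *
          qBinom (q ^ 3) (2 * n) t.1.2) := by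
  refine mul_left_cancel₀ (pow_ne_zero ((3 * n).choose 2) hq) ?_
  rw [qBinom_trisection, tripleIdx, sum_sigma, mul_sum]
  refine sum_congr rfl fun x hx => ?_
  rw [mul_sum]
  refine sum_congr rfl fun y hy => ?_
  rw [HasAntidiagonal.mem_antidiagonal] at hx hy
  rw [trisection_exponent (show y.1 + y.2 + x.2 = 3 * n by omega), pow_add]
  dsimp only
  ring

theorem ncard_eisForm_eq_card_tripleIdx {m n : ℕ} (hn : 2 * m + 1 ≤ n) :
    {p : ℤ × ℤ | eisForm p.1 p.2 = m}.ncard =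
      #{t ∈ tripleIdx n | m = (eisForm (t.2.1 - n) (t.2.2 - n)).toNat} := by
  have : {p : ℤ × ℤ | eisForm p.1 p.2 = m} =
      (fun t : (Σ _ : ℕ × ℕ, ℕ × ℕ) => ((t.2.1 : ℤ) - n, (t.2.2 : ℤ) - n)) ''
        ({t ∈ tripleIdx n | m = (eisForm (t.2.1 - n) (t.2.2 - n)).toNat} : Finset _) := by
    ext ⟨a, b⟩
    simp only [Set.mem_ofPred_eq, Set.mem_image, coe_filter, Prod.mk.injEq]
    constructor
    · intro h
      obtain ⟨h1, h2, h3⟩ := eisForm_bounds h.le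
      rw [abs_le] at h1 h2 h3
      refine ⟨⟨(((2 * n + a + b).toNat), (n - a - b).toNat), ((n + a).toNat, (n + b).toNat)⟩,
        ⟨?_, ?_⟩, ?_, ?_⟩
      · simp only [tripleIdx, mem_sigma, HasAntidiagonal.mem_antidiagonal]
        omega
      · rw [show (((n + a).toNat : ℕ) : ℤ) - n = a by omega,
          show (((n + b).toNat : ℕ) : ℤ) - n = b by omega, h, Int.toNat_natCast]
      · dsimp only; omega
      · dsimp only; omega
    · rintro ⟨t, ⟨-, ht⟩, rfl, rfl⟩
      have := eisForm_nonneg (t.2.1 - n) (t.2.2 - n)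
      omega
  rw [this, Set.InjOn.ncard_image, Set.ncard_coe_finset]
  rintro ⟨⟨x1, x2⟩, y1, y2⟩ ht ⟨⟨x1', x2'⟩, y1', y2'⟩ ht' h
  simp only [tripleIdx, coe_filter, Set.mem_ofPred_eq, mem_sigma, HasAntidiagonal.mem_antidiagonal,
    Prod.mk.injEq] at ht ht' h
  obtain ⟨rfl, rfl, rfl, rfl⟩ : x1 = x1' ∧ x2 = x2' ∧ y1 = y1' ∧ y2 = y2' := by omega
  rfl

theorem ncard_eisForm_four_mul_add_one (m : ℕ) :
    {p : ℤ × ℤ | eisForm p.1 p.2 = (4 * m + 1 : ℕ)}.ncard =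
      {p : ℤ × ℤ | eisForm p.1 p.2 = m}.ncard := by
  have : {p : ℤ × ℤ | eisForm p.1 p.2 = (4 * m + 1 : ℕ)} =
      (fun p : ℤ × ℤ => (1 - 2 * p.1, -2 * p.2)) '' {p : ℤ × ℤ | eisForm p.1 p.2 = m} := by
    ext ⟨a, b⟩
    simp only [Set.mem_ofPred_eq, Set.mem_image, Prod.mk.injEq, Prod.exists]
    constructor
    · intro h
      -- Modulo 2, E ≡ a(1 + b), so E = 4m + 1 forces a odd and b even.
      have hodd : Odd (a * (1 + b)) := by
        have e : a * (1 + b) + (b * (b + 1) + a * (a + 1) + 2 * (a ^ 2 + a * b + b ^ 2) - 4 * a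
            - 2 * b) = 4 * m + 1 := by
          unfold eisForm at h
          push_cast at h
          linear_combination h
        have h1 := Int.even_mul_succ_self a
        have h2 := Int.even_mul_succ_self b
        grind
      obtain ⟨ha, hb⟩ := Int.odd_mul.1 hodd
      obtain ⟨c, rfl⟩ := ha
      obtain ⟨d, hd⟩ := hb
      obtain rfl : b = 2 * d := by omega
      refine ⟨-c, -d, ?_, by ring, by ring⟩
      unfold eisForm at h ⊢
      push_cast at h
      refine mul_left_cancel₀ (four_ne_zero (α := ℤ)) ?_
      linear_combination h
    · rintro ⟨c, d, h, rfl, rfl⟩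
      unfold eisForm at h ⊢
      push_cast
      linear_combination 4 * h
  rw [this, Set.ncard_image_of_injective]
  rintro ⟨a, b⟩ ⟨c, d⟩ h
  simp only [Prod.mk.injEq] at h ⊢
  omega

/-! ### Generating functions modulo 3 -/

theorem PowerSeries.charP_of_charP (R : Type*) [CommRing R] (p : ℕ) [CharP R p] :
    CharP (PowerSeries R) p :=
  charP_of_injective_ringHom (PowerSeries.C_injective (R := R)) p

open PowerSeries in
theorem coeff_qPoch_pow_eight (m : ℕ) :
    PowerSeries.coeff m (qPoch (X : (ZMod 3)⟦X⟧) m ^ 8) =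
      ({p : ℤ × ℤ | eisForm p.1 p.2 = m}.ncard : ZMod 3) := by
  have _ := PowerSeries.charP_of_charP (ZMod 3) 3
  -- If E ≤ m, the lower indices lie within m + 1 of n, hence in [m, 2n - m]: exactly the range
  -- where the binomials stabilise.
  obtain ⟨n, hn⟩ : ∃ n, n = 2 * m + 1 := ⟨_, rfl⟩
  let I : Ideal (ZMod 3)⟦X⟧ := Ideal.span {X ^ (m + 1)}
  let f := Ideal.Quotient.mk I
  have hX : f X ^ (m + 1) = 0 := by
    rw [← map_pow, Ideal.Quotient.eq_zero_iff_mem]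
    exact Ideal.mem_span_singleton_self _
  have hX3 : (f X ^ 3) ^ (m + 1) = 0 := by rw [← pow_mul, mul_comm, pow_mul, hX, zero_pow (by simp)]
  have h3 : f (qPoch X m) ^ 3 = qPoch (f X ^ 3) m := by
    rw [← map_pow, ← qPoch_pow_char 3, map_qPoch, map_pow]
  have hf : f (qPoch X m ^ 8) =
      f (∑ t ∈ tripleIdx n, X ^ (eisForm (t.2.1 - n) (t.2.2 - n)).toNat) := by
    have h0 := congrArg f (qBinom_six_three (X_ne_zero (R := ZMod 3)) n)
    have h1 : qBinom (f X) (3 * (2 * n)) (3 * n) * f (qPoch X m) = 1 := by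
      rw [map_qPoch]
      exact qBinom_mul_qPoch_of_pow_eq_zero hX (by omega) (by omega)
    rw [map_qBinom] at h0
    calc f (qPoch X m ^ 8) = qBinom (f X) (3 * (2 * n)) (3 * n) * f (qPoch X m) ^ 9 := by
          rw [map_pow]
          linear_combination (-f (qPoch X m) ^ 8) * h1
      _ = _ := by
          rw [h0, map_sum, map_sum, sum_mul]
          refine sum_congr rfl fun t ht => ?_
          simp only [map_mul, map_pow, map_qBinom]
          by_cases hE : (eisForm (t.2.1 - n) (t.2.2 - n)).toNat ≤ m
          · obtain ⟨b1, b2, b3⟩ := eisForm_bounds (show eisForm (t.2.1 - n) (t.2.2 - n) ≤ m by omega)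
            rw [abs_le] at b1 b2 b3
            simp only [tripleIdx, mem_sigma, HasAntidiagonal.mem_antidiagonal] at ht
            have g1 := qBinom_mul_qPoch_of_pow_eq_zero hX3 (n := 2 * n) (k := t.2.1)
              (by omega) (by omega)
            have g2 := qBinom_mul_qPoch_of_pow_eq_zero hX3 (n := 2 * n) (k := t.2.2)
              (by omega) (by omega)
            have g3 := qBinom_mul_qPoch_of_pow_eq_zero hX3 (n := 2 * n) (k := t.1.2)
              (by omega) (by omega)
            rw [show f (qPoch X m) ^ 9 = (f (qPoch X m) ^ 3) ^ 3 by ring, h3]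
            generalize qPoch (f X ^ 3) m = P at *
            calc _ = f X ^ (eisForm (t.2.1 - n) (t.2.2 - n)).toNat *
                  ((qBinom (f X ^ 3) (2 * n) t.2.1 * P) * (qBinom (f X ^ 3) (2 * n) t.2.2 * P) *
                    (qBinom (f X ^ 3) (2 * n) t.1.2 * P)) := by ring
              _ = _ := by rw [g1, g2, g3]; ring
          · rw [pow_eq_zero_of_le (by omega) hX]
            ring
  rw [Ideal.Quotient.eq, Ideal.mem_span_singleton, X_pow_dvd_iff] at hf
  have := hf m (by omega)
  rw [map_sub, sub_eq_zero] at this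
  rw [this, map_sum, ncard_eisForm_eq_card_tripleIdx hn.ge]
  simp only [coeff_X_pow, sum_boole]

-- By Glaisher, count partitions with each part used fewer than 9 times: each factor is a geometric
-- sum, ≡ (1 - X^i)^8.
open PowerSeries PowerSeries.WithPiTopology in
theorem cast_Rreg_nine (m : ℕ) :
    (Rreg 9 m : ZMod 3) = PowerSeries.coeff m (qPoch (X : (ZMod 3)⟦X⟧) m ^ 8) := by
  have _ := PowerSeries.charP_of_charP (ZMod 3) 3
  let _ : TopologicalSpace (ZMod 3) := ⊥
  have _ : DiscreteTopology (ZMod 3) := ⟨rfl⟩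
  have h := (Nat.Partition.hasProd_powerSeriesMk_card_countRestricted (ZMod 3)
    (show 0 < 9 by norm_num)).tendsto_prod_nat
  have e : ∀ N, ∏ i ∈ range N, ∑ j ∈ range 9, (X : (ZMod 3)⟦X⟧) ^ ((i + 1) * j) =
      qPoch X N ^ 8 := fun N => by
    rw [qPoch, ← prod_pow]
    refine prod_congr rfl fun i _ => ?_
    have hne : (1 - X ^ (i + 1) : (ZMod 3)⟦X⟧) ≠ 0 := fun h => by
      simpa using congrArg constantCoeff h
    refine mul_right_cancel₀ hne ?_
    simp only [pow_mul]
    rw [geom_sum_mul_neg, ← pow_succ, show 8 + 1 = 3 ^ 2 by norm_num, show 9 = 3 ^ 2 by norm_num,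
      sub_pow_char_pow, one_pow]
  simp only [e] at h
  rw [tendsto_iff_coeff_tendsto] at h
  have h' := h m
  rw [coeff_mk] at h'
  have hc : Filter.Tendsto (fun N => PowerSeries.coeff m (qPoch (X : (ZMod 3)⟦X⟧) N ^ 8))
      Filter.atTop (nhds (PowerSeries.coeff m (qPoch (X : (ZMod 3)⟦X⟧) m ^ 8))) := by
    refine tendsto_atTop_of_eventually_const (i₀ := m) fun N hN => ?_
    let f := Ideal.Quotient.mk (Ideal.span {(X : (ZMod 3)⟦X⟧) ^ (m + 1)})
    have hX : f X ^ (m + 1) = 0 := by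
      rw [← map_pow, Ideal.Quotient.eq_zero_iff_mem]
      exact Ideal.mem_span_singleton_self _
    have : f (qPoch X N ^ 8) = f (qPoch X m ^ 8) := by
      rw [map_pow, map_pow, map_qPoch, map_qPoch, qPoch_eq_of_pow_eq_zero hX hN]
    rw [Ideal.Quotient.eq, Ideal.mem_span_singleton, X_pow_dvd_iff] at this
    simpa [sub_eq_zero] using this m (by omega)
  rw [← tendsto_nhds_unique h' hc, Rreg,
    Nat.Partition.card_restricted_eq_card_countRestricted m (by norm_num)]

theorem Rreg_nine_modEq (m : ℕ) :
    Rreg 9 m ≡ {p : ℤ × ℤ | eisForm p.1 p.2 = m}.ncard [MOD 3] := by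
  rw [← ZMod.natCast_eq_natCast_iff, cast_Rreg_nine, coeff_qPoch_pow_eight]

theorem Rreg_nine_four_mul_add_one (n : ℕ) : Rreg 9 (4 * n + 1) ≡ Rreg 9 n [MOD 3] :=
  ((Rreg_nine_modEq _).trans (by rw [ncard_eisForm_four_mul_add_one])).trans
    (Rreg_nine_modEq n).symm

theorem ncard_eisForm_eq_card_box (m : ℕ) :
    {p : ℤ × ℤ | eisForm p.1 p.2 = m}.ncard =
      #{p ∈ Icc (-(m + 1) : ℤ) (m + 1) ×ˢ Icc (-(m + 1) : ℤ) (m + 1) | eisForm p.1 p.2 = m} := by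
  rw [← Set.ncard_coe_finset]
  congr 1
  ext ⟨a, b⟩
  simp only [Set.mem_ofPred_eq, coe_filter, mem_product, mem_Icc]
  refine ⟨fun h => ?_, fun h => h.2⟩
  obtain ⟨h1, h2, -⟩ := eisForm_bounds h.le
  exact ⟨⟨abs_le.1 h1, abs_le.1 h2⟩, h⟩

theorem Rreg_nine_one_modEq : Rreg 9 1 ≡ 1 [MOD 3] := by
  refine (Rreg_nine_modEq 1).trans ?_
  rw [ncard_eisForm_eq_card_box]
  decide +kernel

theorem Rreg_nine_two_modEq : Rreg 9 2 ≡ 2 [MOD 3] := by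
  refine (Rreg_nine_modEq 2).trans ?_
  rw [ncard_eisForm_eq_card_box]
  decide +kernel

theorem Rreg_nine_three_modEq : Rreg 9 3 ≡ 0 [MOD 3] := by
  refine (Rreg_nine_modEq 3).trans ?_
  rw [ncard_eisForm_eq_card_box]
  decide +kernel

/-- The argument is N ↦ 4N + 1 applied s times to r + 1. -/
theorem Rreg_nine_iterate (r s : ℕ) :
    Rreg 9 (r * 4 ^ s + (4 ^ (s + 1) - 1) / 3) ≡ Rreg 9 (r + 1) [MOD 3] := by
  induction s with
  | zero => simpa using Nat.ModEq.refl _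
  | succ s ih =>
    refine Nat.ModEq.trans ?_ ih
    have e : r * 4 ^ (s + 1) + (4 ^ (s + 1 + 1) - 1) / 3 =
        4 * (r * 4 ^ s + (4 ^ (s + 1) - 1) / 3) + 1 := by
      have h : (4 ^ (s + 1)) % 3 = 1 := by simp [Nat.pow_mod]
      have h2 : 4 ^ (s + 1 + 1) = 4 * 4 ^ (s + 1) := pow_succ' _ _
      have h3 : r * 4 ^ (s + 1) = 4 * (r * 4 ^ s) := by ring
      omega
    rw [e]
    exact Rreg_nine_four_mul_add_one _

end

theorem mainTheorem12 :
    (∀ n : ℕ, Rreg 9 (4 * n + 1) ≡ Rreg 9 n [MOD 3]) ∧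
    (∀ r s : ℕ, 1 ≤ r → 1 ≤ s →
      Rreg 9 ((r - 1) * 4 ^ (s - 1) + (4 ^ s - 1) / 3) ≡ Rreg 9 r [MOD 3]) ∧
    (∀ s : ℕ, 1 ≤ s →
      Rreg 9 ((4 ^ s - 1) / 3) ≡ 1 [MOD 3] ∧
      Rreg 9 (4 ^ (s - 1) + (4 ^ s - 1) / 3) ≡ 2 [MOD 3] ∧
      Rreg 9 (2 * 4 ^ (s - 1) + (4 ^ s - 1) / 3) ≡ 0 [MOD 3]) := by
  refine ⟨Rreg_nine_four_mul_add_one, fun r s hr hs => ?_, fun s hs => ?_⟩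
  · obtain ⟨r, rfl⟩ := Nat.exists_eq_add_of_le' hr
    obtain ⟨s, rfl⟩ := Nat.exists_eq_add_of_le' hs
    exact Rreg_nine_iterate r s
  · obtain ⟨s, rfl⟩ := Nat.exists_eq_add_of_le' hs
    refine ⟨?_, ?_, (Rreg_nine_iterate 2 s).trans Rreg_nine_three_modEq⟩
    · simpa using (Rreg_nine_iterate 0 s).trans Rreg_nine_one_modEq
    · simpa using (Rreg_nine_iterate 1 s).trans Rreg_nine_two_modEq
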